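/- Let $X$ be a real Banach space with dual space $X^*$, and let $\mathrm{dist}$ denote the distance in the norm (of $X$ or of $X^*$), with $\mathrm{dist}(0,\varnothing)=+\infty$ and $\inf\varnothing=+\infty$. Definitions. For a nonempty, convex, weak$^*$ compact set $A\subseteq X^*$ let $s_A(v)=\max_{\xi\in A}\langle\xi,v\rangle$ be its support function. A function $\varphi:X\to\mathbb R$ is quasidifferentiable (q.d.) at $x$ if the directional derivative $\varphi'(x;v)=\lim_{t\to0^+}\frac{\varphi(x+tv)-\varphi(x)}{t}$ exists in $\mathbb R$ for every $v\in X$ and $\varphi'(x;\cdot)$ is a difference of two continuous sublinear functions; equivalently, $\varphi'(x;\cdot)=s_A-s_B$ for some nonempty, convex, weak$^*$ compact $A,B\subseteq X^*$. In that case put $$\mathcal D\varphi(x)=\partial^{C}(s_A-s_B)(0),$$ where $\partial^{C}$ is the Clarke subdifferential, that is, $\partial^C\psi(0)=\{\xi\in X^*:\ \langle\xi,v\rangle\le\limsup_{y\to0,\,t\downarrow0}\frac{\psi(y+tv)-\psi(y)}{t}\ \ \forall v\in X\}$. (So $\mathcal D\varphi(x)$ is the Demyanov difference of $A$ and $B$;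 it does not depend on the choice of the pair $(A,B)$.) Theorem. Let $f,g,h:X\to\mathbb R$ be q.d. at each point of $X$, with $f$ and $g$ lower semicontinuous and $h$ continuous. Let $\Omega=\{x\in X:\ g(x)\le0,\ h(x)=0\}$, let $S=\{x\in\Omega:\ f(x)\le f(y)\ \forall y\in\Omega\}$ be the set of global solutions of the problem of minimizing $f(x)$ subject to $g(x)\le0$, $h(x)=0$, and let $[g]_+=\max\{g,0\}$. Suppose that (i) $S\neq\varnothing$; (ii) $\tau>0$ is such that $\displaystyle\inf_{x\in X\setminus\Omega}\mathrm{dist}\bigl(0,\ \mathcal D[g]_+(x)+\mathcal D|h|(x)\bigr)\ge\tau$; (iii) $f$ is Lipschitz continuous on $X$ with constant $\ell_f$; (iv) for some $\lambda>\ell_f$ and $\zeta>0$, $$\inf_{x\in X\setminus S}\mathrm{dist}\Bigl(0,\ \mathcal Df(x)+\lambda\tau^{-1}\bigl(\mathcal D[g]_+(x)+\mathcal D|h|(x)\bigr)\Bigr)\ge\zeta .$$ Then the solutions of the problem are constrained global weak sharp minimizers, that is, $S\ne\varnothing$ and there is $\sigma>0$ such that $$\sigma\,\mathrm{dist}(x,S)\le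 f(x)-\inf_{y\in\Omega}f(y)\qquad\text{for all }x\in\Omega,$$ and the modulus of constrained global weak sharpness, i.e. the supremum in $(0,+\infty]$ of all $\sigma>0$ satisfying this inequality, is at least $\zeta$. -/

import Mathlib

open Filter Topology Set
open scoped NNReal ENNReal Pointwise

namespace QD

noncomputable section

variable {X : Type*} [NormedAddCommGroup X] [NormedSpace ℝ X]

/-- `p` is a continuous sublinear function on `X`. -/
structure IsSLin (p : X → ℝ) : Prop where
  continuous : Continuous p
  add_le : ∀ u v, p (u + v) ≤ p u + p v
  pos_smul : ∀ (t : ℝ) (v : X), 0 < t → p (t • v) = t * p v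

/-- `A` is a nonempty, convex and weak* compact subset of the dual space of `X`. -/
structure IsConvComp (A : Set (StrongDual ℝ X)) : Prop where
  nonempty : A.Nonempty
  convex : Convex ℝ A
  isCompact : IsCompact (WeakDual.toStrongDual ⁻¹' A : Set (WeakDual ℝ X))

/-- The support function `v ↦ max_{ξ ∈ A} ⟨ξ, v⟩` of a set `A` of functionals. -/
def supp (A : Set (StrongDual ℝ X)) (v : X) : ℝ :=
  sSup ((fun ξ : StrongDual ℝ X => ξ v) '' A)

/-- `L` is the (one-sided) directional derivative `f'(x; v)`. -/
def HasDirDeriv (f : X → ℝ) (x v : X) (L : ℝ) : Prop :=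
  Tendsto (fun t : ℝ => (f (x + t • v) - f x) / t) (𝓝[>] 0) (𝓝 L)

/-- `f` is quasidifferentiable at `x`: its directional derivative at `x` exists in all
directions and is a difference of two continuous sublinear functions. -/
def QDAt (f : X → ℝ) (x : X) : Prop :=
  ∃ p q : X → ℝ, IsSLin p ∧ IsSLin q ∧ ∀ v, HasDirDeriv f x v (p v - q v)

/-- The quasidifferential of `f` at `x`: all the pairs `(A, B)` of nonempty convex weak* compact
sets such that `f'(x; v) = supp A v - supp B v` for every `v`. -/
def quasidiff (f : X → ℝ) (x : X) : Set (Set (StrongDual ℝ X) × Set (StrongDual ℝ X)) :=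
  {P | IsConvComp P.1 ∧ IsConvComp P.2 ∧ ∀ v, HasDirDeriv f x v (supp P.1 v - supp P.2 v)}

/-- The Clarke generalized directional derivative
`φ°(x; v) = limsup_{y → x, t ↓ 0} (φ (y + t v) - φ y) / t`. -/
def clarkeDeriv (φ : X → ℝ) (x v : X) : EReal :=
  limsup (fun z : X × ℝ => (((φ (z.1 + z.2 • v) - φ z.1) / z.2 : ℝ) : EReal))
    (𝓝 x ×ˢ 𝓝[>] (0 : ℝ))

/-- The Clarke subdifferential of `φ` at `x`. -/
def clarkeSubdiff (φ : X → ℝ) (x : X) : Set (StrongDual ℝ X) :=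
  {ξ | ∀ v, ((ξ v : ℝ) : EReal) ≤ clarkeDeriv φ x v}

/-- The Demyanov difference of `A` and `B`. -/
def demDiff (A B : Set (StrongDual ℝ X)) : Set (StrongDual ℝ X) :=
  clarkeSubdiff (fun v => supp A v - supp B v) 0

/-- The derivative construction `ⅅf(x)`: the Demyanov difference of the two members of a pair in
the quasidifferential of `f` at `x`. All the pairs give the same set
(see `demcoqd_eq_demDiff`), and there is such a pair if `f` is quasidifferentiable at `x`
(see `QDAt.quasidiff_nonempty`). -/
def demcoqd (f : X → ℝ) (x : X) : Set (StrongDual ℝ X) :=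
  ⋃ P ∈ quasidiff f x, demDiff P.1 P.2

theorem demcoqd_eq_demDiff {f : X → ℝ} {x : X} {A B : Set (StrongDual ℝ X)}
    (h : (A, B) ∈ quasidiff f x) : demcoqd f x = demDiff A B := by
  have key : ∀ P ∈ quasidiff f x, demDiff P.1 P.2 = demDiff A B := by
    intro P hP
    unfold demDiff
    congr 1
    funext v
    exact tendsto_nhds_unique (hP.2.2 v) (h.2.2 v)
  ext ξ
  simp only [demcoqd, mem_iUnion]
  constructor
  · rintro ⟨P, hP, hξ⟩
    exact key P hP ▸ hξ
  · intro hξ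
    exact ⟨(A, B), h, hξ⟩

theorem IsSLin.map_zero {p : X → ℝ} (hp : IsSLin p) : p 0 = 0 := by
  have := hp.pos_smul 2 0 (by norm_num)
  rw [smul_zero] at this
  linarith

/-- Every continuous sublinear function is the support function of a nonempty convex weak*
compact set. -/
theorem IsSLin.exists_supp_eq {p : X → ℝ} (hp : IsSLin p) :
    ∃ A : Set (StrongDual ℝ X), IsConvComp A ∧ ∀ v, supp A v = p v := by
  obtain ⟨C, hC⟩ : ∃ C : ℝ, ∀ v, p v ≤ C * ‖v‖ := by
    have h1 : ∀ᶠ v in 𝓝 (0 : X), p v < 1 :=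
      hp.continuous.continuousAt.eventually_lt_const (by rw [hp.map_zero]; norm_num)
    obtain ⟨r, hr, hb⟩ := Metric.eventually_nhds_iff.1 h1
    refine ⟨2 / r, fun v => ?_⟩
    rcases eq_or_ne v 0 with rfl | hv
    · simp [hp.map_zero]
    have hn : 0 < ‖v‖ := norm_pos_iff.2 hv
    have ht : 0 < r / (2 * ‖v‖) := by positivity
    have h2 : p ((r / (2 * ‖v‖)) • v) < 1 := by
      apply hb
      rw [dist_zero_right, norm_smul, Real.norm_of_nonneg ht.le]
      field_simp
      linarith
    rw [hp.pos_smul _ _ ht] at h2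
    have h3 : r * p v < 2 * ‖v‖ := by
      field_simp at h2
      linarith
    rw [div_mul_eq_mul_div, le_div_iff₀ hr]
    linarith
  let A : Set (StrongDual ℝ X) := {ξ | ∀ v, ξ v ≤ p v}
  have ext : ∀ v, ∃ ξ ∈ A, ξ v = p v := by
    intro v
    have hz : ∀ u : X, -p (-u) ≤ p u := by
      intro u
      have := hp.add_le u (-u)
      rw [add_neg_cancel, hp.map_zero] at this
      linarith
    let F : X →ₗ.[ℝ] ℝ := LinearPMap.mkSpanSingleton' v (p v) (by
      intro c hc
      rcases smul_eq_zero.1 hc with h | h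
      · simp [h]
      · simp [h, hp.map_zero])
    obtain ⟨g, hg1, hg2⟩ := exists_extension_of_le_sublinear F p
      (fun c hc x => hp.pos_smul c x hc) hp.add_le (by
        rintro ⟨w, hw⟩
        obtain ⟨c, rfl⟩ := Submodule.mem_span_singleton.1 hw
        have : F ⟨c • v, hw⟩ = c • p v := LinearPMap.mkSpanSingleton'_apply _ _ _ c hw
        rw [this, smul_eq_mul]
        rcases lt_trichotomy c 0 with h | h | h
        · have h4 := hp.pos_smul (-c) (-v) (by linarith)
          rw [smul_neg, neg_smul, neg_neg] at h4
          change c * p v ≤ p (c • v)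
          rw [h4]
          have := hz v
          nlinarith
        · simp [h, hp.map_zero]
        · exact (hp.pos_smul c v h).ge)
    have hle : ∀ u, |g u| ≤ C * ‖u‖ := by
      intro u
      refine abs_le.2 ⟨?_, (hg2 u).trans (hC u)⟩
      have h5 := (hg2 (-u)).trans (hC (-u))
      rw [map_neg, norm_neg] at h5
      linarith
    refine ⟨g.mkContinuous C hle, fun u => hg2 u, ?_⟩
    have hv : v ∈ F.domain := Submodule.mem_span_singleton_self v
    have h6 : F ⟨v, hv⟩ = p v := by
      have h7 : F ⟨(1 : ℝ) • v, by rw [one_smul]; exact hv⟩ = (1 : ℝ) • p v :=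
        LinearPMap.mkSpanSingleton'_apply _ _ _ _ _
      simpa only [one_smul] using h7
    exact (hg1 ⟨v, hv⟩).trans h6
  refine ⟨A, ⟨?_, ?_, ?_⟩, fun v => ?_⟩
  · obtain ⟨ξ, hξ, -⟩ := ext 0
    exact ⟨ξ, hξ⟩
  · intro ξ hξ η hη a b ha hb hab v
    have h1 := mul_le_mul_of_nonneg_left (hξ v) ha
    have h2 := mul_le_mul_of_nonneg_left (hη v) hb
    have h3 : a * p v + b * p v = p v := by rw [← add_mul, hab, one_mul]
    change a * ξ v + b * η v ≤ p v
    linarith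
  · have hcl : IsClosed (WeakDual.toStrongDual ⁻¹' A : Set (WeakDual ℝ X)) := by
      have : (WeakDual.toStrongDual ⁻¹' A : Set (WeakDual ℝ X)) =
          ⋂ v : X, {ξ : WeakDual ℝ X | ξ v ≤ p v} := by
        ext ξ
        simp only [mem_iInter]
        rfl
      rw [this]
      exact isClosed_iInter fun v => isClosed_le (WeakDual.eval_continuous v) continuous_const
    refine (WeakDual.isCompact_closedBall (𝕜 := ℝ) (E := X) 0 (max C 0)).of_isClosed_subset hcl ?_
    intro ξ hξ
    have hξ' : ∀ v, WeakDual.toStrongDual ξ v ≤ p v := hξ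
    rw [mem_preimage, mem_closedBall_zero_iff]
    refine ContinuousLinearMap.opNorm_le_bound _ (le_max_right _ _) fun u => ?_
    have h0 : C * ‖u‖ ≤ max C 0 * ‖u‖ :=
      mul_le_mul_of_nonneg_right (le_max_left _ _) (norm_nonneg _)
    refine abs_le.2 ⟨?_, ((hξ' u).trans (hC u)).trans h0⟩
    have h5 := (hξ' (-u)).trans (hC (-u))
    rw [map_neg, norm_neg] at h5
    linarith
  · obtain ⟨ξ, hξ, hv⟩ := ext v
    refine IsGreatest.csSup_eq ⟨⟨ξ, hξ, hv⟩, ?_⟩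
    rintro _ ⟨η, hη, rfl⟩
    exact hη v

theorem QDAt.quasidiff_nonempty {f : X → ℝ} {x : X} (h : QDAt f x) : (quasidiff f x).Nonempty := by
  obtain ⟨p, q, hp, hq, hd⟩ := h
  obtain ⟨A, hA, hA'⟩ := hp.exists_supp_eq
  obtain ⟨B, hB, hB'⟩ := hq.exists_supp_eq
  refine ⟨(A, B), hA, hB, fun v => ?_⟩
  simpa only [hA', hB'] using hd v

/-- The feasible region `Ω` of the problem: minimize `f x` subject to `g x ≤ 0`, `h x = 0`. -/
def feasible (g h : X → ℝ) : Set X := {x | g x ≤ 0 ∧ h x = 0}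

/-- The set of the global minimizers of `f` over `Ω`. -/
def argminOn (f : X → ℝ) (Ω : Set X) : Set X := {x | x ∈ Ω ∧ ∀ y ∈ Ω, f x ≤ f y}

/-- The problem: minimize `f x` subject to `g x ≤ 0`, `h x = 0` is a q.d. problem. -/
structure IsQDProblem (f g h : X → ℝ) : Prop where
  qd_f : ∀ x, QDAt f x
  qd_g : ∀ x, QDAt g x
  qd_h : ∀ x, QDAt h x
  lsc_f : LowerSemicontinuous f
  lsc_g : LowerSemicontinuous g
  continuous_h : Continuous h

/-- The inequality `σ dist(x, Argmin) ≤ f x - inf_Ω f` on `Ω` that defines constrained global weak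
sharpness. -/
def WeakSharpIneq (f : X → ℝ) (Ω : Set X) (σ : ℝ) : Prop :=
  ∀ x ∈ Ω, σ * Metric.infDist x (argminOn f Ω) ≤ f x - sInf (f '' Ω)

/-- The problem of minimizing `f` over `Ω` admits constrained global weak sharp minimizers. -/
def AdmitsWeakSharp (f : X → ℝ) (Ω : Set X) : Prop :=
  (argminOn f Ω).Nonempty ∧ ∃ σ : ℝ, 0 < σ ∧ WeakSharpIneq f Ω σ

/-- The modulus of constrained global weak sharpness, `⊤` if the inequality holds for arbitrarily
large `σ`. -/
def wsharModulus (f : X → ℝ) (Ω : Set X) : EReal :=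
  ⨆ σ : {σ : ℝ // 0 < σ ∧ WeakSharpIneq f Ω σ}, ((σ : ℝ) : EReal)

end

end QD

/-! Put `ρ = max g 0 + |h|`, which is nonnegative and vanishes on `Ω`. The proof applies one
principle twice: a lower semicontinuous function bounded below by `m` satisfies a global error bound
with constant `ζ` if no point off the target set, where the function equals `m`, minimizes the
function perturbed by `c * dist · z` with `c < ζ` (`mul_infDist_le_of_forall_exists_lt`, from
Ekeland). At such a minimizer the sum rules would give an element of norm at most `c < ζ` in the sum
of derivative sets, against nondegeneracy.

For `ρ` this yields `τ dist(x, Ω) ≤ ρ x`. As `f` is `ℓ`-Lipschitz and `ℓ < lam`, the penalty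
function `φ = f + lam τ⁻¹ ρ` is bounded below by the optimal value. The principle for `φ` and `S`
gives `ζ dist(x, S) ≤ φ x - min f`, and `φ = f` on `Ω`. So `ζ` itself is an admissible modulus.

The sum rules rest on sublinear majorants of the possibly nonconvex directional derivatives
(`QDAt.exists_majorant`); these can be added and then split by Hahn-Banach. -/

namespace QD

/-! ### Ekeland's principle and global error bounds. -/

/-- Ekeland's variational principle. -/
theorem exists_ekeland_point {E : Type*} [MetricSpace E] [CompleteSpace E] {φ : E → ℝ}
    (hφ : LowerSemicontinuous φ) {m : ℝ} (hm : ∀ x, m ≤ φ x) {c : ℝ} (hc : 0 < c) (x : E) :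
    ∃ z, φ z + c * dist z x ≤ φ x ∧ ∀ y, φ z ≤ φ y + c * dist y z := by
  let T : E → Set E := fun u => {y | φ y + c * dist y u ≤ φ u}
  have hself : ∀ u, u ∈ T u := fun u => by simp [T]
  have htrans : ∀ u v, v ∈ T u → T v ⊆ T u := by
    intro u v hv y hy
    have h1 : φ v + c * dist v u ≤ φ u := hv
    have h2 : φ y + c * dist y v ≤ φ v := hy
    have h3 := mul_le_mul_of_nonneg_left (dist_triangle y v u) hc.le
    change φ y + c * dist y u ≤ φ u
    linarith
  have hclosed : ∀ u, IsClosed (T u) := by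
    intro u
    have hlsc : LowerSemicontinuous fun y => φ y + c * dist y u :=
      hφ.add (by fun_prop : Continuous fun y => c * dist y u).lowerSemicontinuous
    exact hlsc.isClosed_preimage (φ u)
  have hbdd : ∀ u, BddBelow (φ '' T u) := fun u => ⟨m, by rintro _ ⟨y, -, rfl⟩; exact hm y⟩
  have hstep : ∀ (n : ℕ) (u : E), ∃ v ∈ T u, ∀ y ∈ T u, φ v ≤ φ y + (1 / 2) ^ n := by
    intro n u
    have hne : (φ '' T u).Nonempty := ⟨_, u, hself u, rfl⟩
    obtain ⟨_, ⟨v, hv, rfl⟩, hlt⟩ :=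
      exists_lt_of_csInf_lt hne (lt_add_of_pos_right (sInf (φ '' T u)) (by positivity :
        (0 : ℝ) < (1 / 2) ^ n))
    refine ⟨v, hv, fun y hy => ?_⟩
    have := csInf_le (hbdd u) ⟨y, hy, rfl⟩
    linarith
  choose next hnext hnext' using hstep
  let s : ℕ → E := fun n => Nat.rec x (fun n u => next n u) n
  have hs : ∀ n, s (n + 1) = next n (s n) := fun n => rfl
  have hanti : Antitone fun n => T (s n) :=
    antitone_nat_of_succ_le fun n => htrans _ _ (by rw [hs]; exact hnext n (s n))
  -- `s (n + 1)` minimizes `φ` over `T (s n)` up to `2⁻ⁿ`, so the nested sets `T (s n)` shrink to a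
  -- point.
  have hdist : ∀ n, ∀ y ∈ T (s (n + 1)), dist y (s (n + 1)) ≤ (1 / 2) ^ n / c := by
    intro n y hy
    have h1 : φ y + c * dist y (s (n + 1)) ≤ φ (s (n + 1)) := hy
    have h2 := hnext' n (s n) y (hanti n.le_succ hy)
    rw [← hs] at h2
    rw [le_div_iff₀ hc]
    linarith
  have hlim : Tendsto (fun n : ℕ => ((1 : ℝ) / 2) ^ n / c) atTop (𝓝 0) := by
    simpa using (tendsto_pow_atTop_nhds_zero_of_lt_one (r := (1 : ℝ) / 2) (by norm_num)
      (by norm_num)).div_const c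
  have hcauchy : CauchySeq fun n => s (n + 1) := by
    refine cauchySeq_of_le_tendsto_0' (fun n : ℕ => ((1 : ℝ) / 2) ^ n / c) (fun n k hnk => ?_) hlim
    rw [dist_comm]
    exact hdist n _ (hanti (Nat.succ_le_succ hnk) (hself _))
  obtain ⟨z, hz⟩ := cauchySeq_tendsto_of_complete hcauchy
  have hzT : ∀ n, z ∈ T (s n) := fun n =>
    (hclosed (s n)).mem_of_tendsto hz
      ((eventually_ge_atTop n).mono fun k hk => hanti (hk.trans k.le_succ) (hself _))
  refine ⟨z, hzT 0, fun y => ?_⟩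
  -- A violating `y` lies in `T z`, hence in every `T (s n)`, so the sequence converges to `y` too
  -- and `y = z`.
  by_contra! hlt
  have hy : ∀ n, y ∈ T (s n) := fun n => htrans _ _ (hzT n) hlt.le
  have hzy : Tendsto (fun n => s (n + 1)) atTop (𝓝 y) := by
    rw [tendsto_iff_dist_tendsto_zero]
    refine squeeze_zero (fun _ => dist_nonneg) (fun n => ?_) hlim
    rw [dist_comm]
    exact hdist n y (hy (n + 1))
  rw [tendsto_nhds_unique hzy hz, dist_self] at hlt
  linarith

/-- A global error bound for a lower semicontinuous function `φ ≥ m` whose points outside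
`S ⊆ {φ = m}` are not minimizers of the perturbations `φ + c * dist · z` for any `c < ζ`. -/
theorem mul_infDist_le_of_forall_exists_lt {E : Type*} [MetricSpace E] [CompleteSpace E]
    {φ : E → ℝ} (hφ : LowerSemicontinuous φ) {m : ℝ} (hm : ∀ x, m ≤ φ x) {S : Set E}
    (hS : ∀ x ∈ S, φ x = m) {ζ : ℝ} (hζ : 0 < ζ)
    (hdec : ∀ z ∉ S, ∀ c, 0 < c → c < ζ → ∃ y, φ y + c * dist y z < φ z) (x : E) :
    ζ * Metric.infDist x S ≤ φ x - m := by
  -- The Ekeland point for `c` must lie in `S`; the constant `ζ` is reached by letting `c ↑ ζ`.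
  have key : ∀ c ∈ Ioo 0 ζ, c * Metric.infDist x S ≤ φ x - m := by
    rintro c ⟨hc, hcζ⟩
    obtain ⟨z, hzx, hz⟩ := exists_ekeland_point hφ hm hc x
    have hzS : z ∈ S := by
      by_contra hzS
      obtain ⟨y, hy⟩ := hdec z hzS c hc hcζ
      linarith [hz y]
    have h1 := mul_le_mul_of_nonneg_left (Metric.infDist_le_dist_of_mem (x := x) hzS) hc.le
    rw [dist_comm] at h1
    linarith [hS z hzS]
  have hlim : Tendsto (fun c : ℝ => c * Metric.infDist x S) (𝓝[<] ζ)
      (𝓝 (ζ * Metric.infDist x S)) :=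
    ((continuous_id.mul continuous_const).tendsto ζ).mono_left nhdsWithin_le_nhds
  exact le_of_tendsto hlim (mem_of_superset (Ioo_mem_nhdsLT hζ) key)

/-! ### Sublinear functions and Hahn-Banach splitting. -/

section

variable {X : Type*} [NormedAddCommGroup X] [NormedSpace ℝ X]

theorem IsSLin.zero : IsSLin fun _ : X => 0 :=
  ⟨continuous_const, fun _ _ => by simp, fun _ _ _ => by simp⟩

theorem IsSLin.add {p q : X → ℝ} (hp : IsSLin p) (hq : IsSLin q) :
    IsSLin fun v => p v + q v where
  continuous := hp.continuous.add hq.continuous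
  add_le u v := by linarith [hp.add_le u v, hq.add_le u v]
  pos_smul t v ht := by rw [hp.pos_smul t v ht, hq.pos_smul t v ht]; ring

theorem IsSLin.const_mul {p : X → ℝ} (hp : IsSLin p) {k : ℝ} (hk : 0 ≤ k) :
    IsSLin fun v => k * p v where
  continuous := continuous_const.mul hp.continuous
  add_le u v := by rw [← mul_add]; exact mul_le_mul_of_nonneg_left (hp.add_le u v) hk
  pos_smul t v ht := by rw [hp.pos_smul t v ht]; ring

theorem IsSLin.max {p q : X → ℝ} (hp : IsSLin p) (hq : IsSLin q) :
    IsSLin fun v => max (p v) (q v) where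
  continuous := hp.continuous.max hq.continuous
  add_le u v := max_le
    ((hp.add_le u v).trans (add_le_add (le_max_left _ _) (le_max_left _ _)))
    ((hq.add_le u v).trans (add_le_add (le_max_right _ _) (le_max_right _ _)))
  pos_smul t v ht := by
    rw [hp.pos_smul t v ht, hq.pos_smul t v ht, mul_max_of_nonneg _ _ ht.le]

theorem isSLin_norm : IsSLin fun v : X => ‖v‖ where
  continuous := continuous_norm
  add_le := norm_add_le
  pos_smul t v ht := by rw [norm_smul, Real.norm_of_nonneg ht.le]

theorem IsSLin.exists_le_mul_norm {p : X → ℝ} (hp : IsSLin p) :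
    ∃ C : ℝ, 0 ≤ C ∧ ∀ v, p v ≤ C * ‖v‖ := by
  have h1 : ∀ᶠ v in 𝓝 (0 : X), p v < 1 :=
    hp.continuous.continuousAt.eventually_lt_const (by rw [hp.map_zero]; norm_num)
  obtain ⟨r, hr, hb⟩ := Metric.eventually_nhds_iff.1 h1
  -- Since `p < 1` on the ball of radius `r`, rescaling `v` to norm `r / 2` gives the constant `2 /
  -- r`.
  refine ⟨2 / r, by positivity, fun v => ?_⟩
  rcases eq_or_ne v 0 with rfl | hv
  · simp [hp.map_zero]
  have hn : 0 < ‖v‖ := norm_pos_iff.2 hv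
  have ht : 0 < r / (2 * ‖v‖) := by positivity
  have h2 : p ((r / (2 * ‖v‖)) • v) < 1 := by
    apply hb
    rw [dist_zero_right, norm_smul, Real.norm_of_nonneg ht.le]
    field_simp
    linarith
  rw [hp.pos_smul _ _ ht] at h2
  have h3 : r * p v < 2 * ‖v‖ := by
    field_simp at h2
    linarith
  rw [div_mul_eq_mul_div, le_div_iff₀ hr]
  linarith

/-- A linear functional majorized by a multiple of the norm is continuous. -/
theorem exists_strongDual_of_le_mul_norm (ξ : X →ₗ[ℝ] ℝ) {C : ℝ} (h : ∀ v, ξ v ≤ C * ‖v‖) :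
    ∃ η : StrongDual ℝ X, ∀ v, η v = ξ v := by
  refine ⟨ξ.mkContinuous C fun v => abs_le.2 ⟨?_, h v⟩, fun v => rfl⟩
  have := h (-v)
  rw [map_neg, norm_neg] at this
  linarith

/-- A functional majorized by a sum of two continuous sublinear functions splits accordingly. -/
theorem IsSLin.exists_add_eq {p q : X → ℝ} (hp : IsSLin p) (hq : IsSLin q) (ξ : StrongDual ℝ X)
    (hξ : ∀ v, ξ v ≤ p v + q v) :
    ∃ η θ : StrongDual ℝ X, η + θ = ξ ∧ (∀ v, η v ≤ p v) ∧ ∀ v, θ v ≤ q v := by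
  -- `(v, v) ↦ ξ v` on the diagonal is extended to `X × X` below `(u, w) ↦ p u + q w`; the two
  -- restrictions to the factors are the summands.
  let diag : Submodule ℝ (X × X) := LinearMap.range (LinearMap.id.prod LinearMap.id : X →ₗ[ℝ] X × X)
  let F : (X × X) →ₗ.[ℝ] ℝ := ⟨diag, (ξ : X →ₗ[ℝ] ℝ) ∘ₗ LinearMap.fst ℝ X X ∘ₗ diag.subtype⟩
  obtain ⟨G, hG, hGle⟩ := exists_extension_of_le_sublinear F (fun z => p z.1 + q z.2)
    (fun c hc z => by
      simp only [Prod.smul_fst, Prod.smul_snd, hp.pos_smul c _ hc, hq.pos_smul c _ hc]; ring)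
    (fun y z => by
      have h1 := hp.add_le y.1 z.1
      have h2 := hq.add_le y.2 z.2
      simp only [Prod.fst_add, Prod.snd_add]
      linarith)
    (by
      rintro ⟨_, v, rfl⟩
      exact hξ v)
  have hleft : ∀ v, G (v, 0) ≤ p v := fun v => by simpa [hq.map_zero] using hGle (v, 0)
  have hright : ∀ v, G (0, v) ≤ q v := fun v => by simpa [hp.map_zero] using hGle (0, v)
  obtain ⟨C, -, hC⟩ := hp.exists_le_mul_norm
  obtain ⟨η, hη⟩ := exists_strongDual_of_le_mul_norm (G ∘ₗ LinearMap.inl ℝ X X)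
    fun v => (hleft v).trans (hC v)
  have hη' : ∀ v, η v = G (v, 0) := hη
  have hsum : ∀ v, G (v, 0) + G (0, v) = ξ v := fun v => by
    rw [← map_add, Prod.mk_add_mk, add_zero, zero_add]
    exact hG ⟨(v, v), v, rfl⟩
  refine ⟨η, ξ - η, add_sub_cancel _ _, fun v => (hη' v).trans_le (hleft v), fun v => ?_⟩
  have := hright v
  simp only [sub_apply, hη', ← hsum v]
  linarith

/-- If `p ≥ -c‖·‖`, then some functional of norm at most `c` is majorized by `p`. -/
theorem IsSLin.exists_norm_le {p : X → ℝ} (hp : IsSLin p) {c : ℝ} (hc : 0 ≤ c)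
    (h : ∀ v, 0 ≤ p v + c * ‖v‖) :
    ∃ ξ : StrongDual ℝ X, ‖ξ‖ ≤ c ∧ ∀ v, ξ v ≤ p v := by
  -- The zero functional is split below `p + c‖·‖`, so `ξ = -θ` with `θ ≤ c‖·‖`.
  obtain ⟨ξ, θ, hsum, hξ, hθ⟩ := hp.exists_add_eq (isSLin_norm.const_mul hc) 0 (by simpa using h)
  refine ⟨ξ, ?_, hξ⟩
  rw [eq_neg_of_add_eq_zero_left hsum, norm_neg]
  refine θ.opNorm_le_bound hc fun v => abs_le.2 ⟨?_, hθ v⟩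
  have := hθ (-v)
  rw [map_neg, norm_neg] at this
  linarith

/-- The Clarke generalized derivative at the origin of a difference of continuous sublinear
functions is bounded from below by a continuous sublinear majorant of this difference. -/
theorem IsSLin.exists_le_clarkeDeriv_sub {p q : X → ℝ} (hp : IsSLin p) (hq : IsSLin q) :
    ∃ P : X → ℝ, IsSLin P ∧ (∀ v, p v - q v ≤ P v) ∧
      ∀ v, (P v : EReal) ≤ clarkeDeriv (fun v => p v - q v) 0 v := by
  obtain ⟨C, hC0, hC⟩ := hp.exists_le_mul_norm
  obtain ⟨D, hD0, hD⟩ := hq.exists_le_mul_norm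
  set ψ : X → ℝ := fun v => p v - q v with hψ
  have hψ0 : ψ 0 = 0 := by simp [hψ, hp.map_zero, hq.map_zero]
  have hψsmul : ∀ (t : ℝ) (v : X), 0 < t → ψ (t • v) = t * ψ v := fun t v ht => by
    simp only [hψ, hp.pos_smul t v ht, hq.pos_smul t v ht]; ring
  have hbound : ∀ v y, ψ (y + v) - ψ y ≤ (C + D) * ‖v‖ := by
    intro v y
    have h1 := hp.add_le y v
    have h2 := hq.add_le (y + v) (-v)
    have h3 := hD (-v)
    rw [add_neg_cancel_right] at h2
    rw [norm_neg] at h3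
    have h4 := hC v
    simp only [hψ]
    linarith
  -- Taking all increments over the whole space makes `P` subadditive by telescoping; `y = 0` shows
  -- that `P` majorizes `ψ`.
  let P : X → ℝ := fun v => ⨆ y, (ψ (y + v) - ψ y)
  have hbdd : ∀ v, BddAbove (range fun y => ψ (y + v) - ψ y) := fun v =>
    ⟨(C + D) * ‖v‖, by rintro _ ⟨y, rfl⟩; exact hbound v y⟩
  have hle : ∀ v y, ψ (y + v) - ψ y ≤ P v := fun v y => le_ciSup (hbdd v) y
  have hPle : ∀ v, P v ≤ (C + D) * ‖v‖ := fun v => ciSup_le (hbound v)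
  have hPadd : ∀ u v, P (u + v) ≤ P u + P v := by
    intro u v
    refine ciSup_le fun y => ?_
    have h1 := hle u y
    have h2 := hle v (y + u)
    rw [add_assoc] at h2
    linarith
  have hPsmul : ∀ (t : ℝ) (v : X), 0 < t → P (t • v) ≤ t * P v := by
    intro t v ht
    refine ciSup_le fun y => ?_
    have h1 : y = t • t⁻¹ • y := by rw [smul_inv_smul₀ ht.ne']
    rw [h1, ← smul_add, hψsmul t _ ht, hψsmul t _ ht, ← mul_sub]
    exact mul_le_mul_of_nonneg_left (hle v _) ht.le
  refine ⟨P, ⟨?_, hPadd, fun t v ht => le_antisymm (hPsmul t v ht) ?_⟩, fun v => ?_, fun v => ?_⟩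
  · refine (LipschitzWith.of_le_add_mul (⟨C + D, add_nonneg hC0 hD0⟩ : ℝ≥0)
      fun u v => ?_).continuous
    have h1 := hPadd v (u - v)
    rw [add_sub_cancel] at h1
    rw [dist_eq_norm]
    exact h1.trans (add_le_add_right (hPle _) _)
  · have h1 := hPsmul t⁻¹ (t • v) (inv_pos.2 ht)
    rw [inv_smul_smul₀ ht.ne'] at h1
    calc t * P v ≤ t * (t⁻¹ * P (t • v)) := mul_le_mul_of_nonneg_left h1 ht.le
      _ = P (t • v) := by rw [mul_inv_cancel_left₀ ht.ne']
  · have h1 := hle v 0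
    rwa [zero_add, hψ0, sub_zero] at h1
  -- By homogeneity the difference quotient is constant along `(t • y, t)`, which tends to the
  -- origin; hence each increment is a lower bound for the limsup.
  · have hquot : ∀ y, ((ψ (y + v) - ψ y : ℝ) : EReal) ≤ clarkeDeriv ψ 0 v := by
      intro y
      have hray : Tendsto (fun t : ℝ => (t • y, t)) (𝓝[>] 0) (𝓝 (0 : X) ×ˢ 𝓝[>] (0 : ℝ)) := by
        refine Tendsto.prodMk (Tendsto.mono_left ?_ nhdsWithin_le_nhds) tendsto_id
        have := (by fun_prop : Continuous fun t : ℝ => t • y).tendsto 0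
        rwa [zero_smul] at this
      refine le_limsup_of_frequently_le' (hray.frequently (Eventually.frequently ?_))
      filter_upwards [self_mem_nhdsWithin] with t ht
      have ht' : 0 < t := ht
      refine EReal.coe_le_coe_iff.2 (le_of_eq ?_)
      rw [← smul_add, hψsmul t _ ht', hψsmul t _ ht', ← mul_sub, mul_div_cancel_left₀ _ ht'.ne']
    generalize clarkeDeriv ψ 0 v = d at hquot
    induction d with
    | bot => exact absurd (hquot 0) (not_le.2 (EReal.bot_lt_coe _))
    | top => exact le_top
    | coe d => exact EReal.coe_le_coe_iff.2 (ciSup_le fun y => EReal.coe_le_coe_iff.1 (hquot y))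

/-! ### Calculus of directional derivatives and quasidifferentiability. -/

theorem HasDirDeriv.neg {f : X → ℝ} {x v : X} {L : ℝ} (hf : HasDirDeriv f x v L) :
    HasDirDeriv (fun y => -f y) x v (-L) := by
  refine (Tendsto.neg hf).congr fun t => ?_
  ring

theorem HasDirDeriv.add {f g : X → ℝ} {x v : X} {L M : ℝ} (hf : HasDirDeriv f x v L)
    (hg : HasDirDeriv g x v M) : HasDirDeriv (fun y => f y + g y) x v (L + M) := by
  refine (Tendsto.add hf hg).congr fun t => ?_
  ring

theorem HasDirDeriv.const_mul {f : X → ℝ} {x v : X} {L : ℝ} (hf : HasDirDeriv f x v L) (k : ℝ) :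
    HasDirDeriv (fun y => k * f y) x v (k * L) := by
  refine (Tendsto.const_mul k hf).congr fun t => ?_
  ring

/-- Keeps the sign of `f` along short rays when `f x ≠ 0`, with no continuity of `f` assumed; `g` is
only lower semicontinuous. -/
theorem HasDirDeriv.tendsto_ray {f : X → ℝ} {x v : X} {L : ℝ} (hf : HasDirDeriv f x v L) :
    Tendsto (fun t : ℝ => f (x + t • v)) (𝓝[>] 0) (𝓝 (f x)) := by
  have h1 : Tendsto (fun t : ℝ => t) (𝓝[>] 0) (𝓝 0) := nhdsWithin_le_nhds
  have h2 := (h1.mul hf).add_const (f x)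
  rw [zero_mul, zero_add] at h2
  refine h2.congr' ?_
  filter_upwards [self_mem_nhdsWithin] with t ht
  rw [mul_div_cancel₀ _ (ne_of_gt ht), sub_add_cancel]

theorem QDAt.neg {f : X → ℝ} {x : X} (hf : QDAt f x) : QDAt (fun y => -f y) x := by
  obtain ⟨p, q, hp, hq, hd⟩ := hf
  exact ⟨q, p, hq, hp, fun v => by simpa using (hd v).neg⟩

theorem QDAt.add {f g : X → ℝ} {x : X} (hf : QDAt f x) (hg : QDAt g x) :
    QDAt (fun y => f y + g y) x := by
  obtain ⟨p, q, hp, hq, hd⟩ := hf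
  obtain ⟨p', q', hp', hq', hd'⟩ := hg
  refine ⟨_, _, hp.add hp', hq.add hq', fun v => ?_⟩
  rw [add_sub_add_comm]
  exact (hd v).add (hd' v)

/-- Only `f x = 0` needs a new decomposition: `max (p - q) 0 = max p q - q`. -/
theorem QDAt.posPart {f : X → ℝ} {x : X} (hf : QDAt f x) : QDAt (fun y => max (f y) 0) x := by
  obtain ⟨p, q, hp, hq, hd⟩ := hf
  rcases lt_trichotomy (f x) 0 with hx | hx | hx
  · refine ⟨_, _, IsSLin.zero, IsSLin.zero, fun v => ?_⟩
    have hev := (hd v).tendsto_ray.eventually_lt_const hx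
    rw [sub_zero]
    refine (tendsto_const_nhds (x := (0 : ℝ))).congr' ?_
    filter_upwards [hev] with t ht
    rw [max_eq_right ht.le, max_eq_right hx.le, sub_zero, zero_div]
  · refine ⟨_, _, hp.max hq, hq, fun v => ?_⟩
    rw [← max_sub_sub_right, sub_self]
    refine ((hd v).max tendsto_const_nhds).congr' ?_
    filter_upwards [self_mem_nhdsWithin] with t ht
    have ht' : 0 < t := ht
    rw [hx, max_self, sub_zero, sub_zero, ← max_div_div_right ht'.le, zero_div]
  · refine ⟨p, q, hp, hq, fun v => ?_⟩
    have hev := (hd v).tendsto_ray.eventually_const_lt hx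
    refine Tendsto.congr' ?_ (hd v)
    filter_upwards [hev] with t ht
    rw [max_eq_left ht.le, max_eq_left hx.le]

theorem QDAt.abs {f : X → ℝ} {x : X} (hf : QDAt f x) : QDAt (fun y => |f y|) x := by
  refine (funext fun y => ?_ : (fun y => |f y|) = fun y => max (f y) 0 + max (-f y) 0) ▸
    hf.posPart.add hf.neg.posPart
  rcases le_total 0 (f y) with h | h
  · rw [abs_of_nonneg h, max_eq_left h, max_eq_right (neg_nonpos.2 h), add_zero]
  · rw [abs_of_nonpos h, max_eq_right h, max_eq_left (neg_nonneg.2 h), zero_add]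

/-! ### Sum rules at perturbed minimizers. -/

/-- The directional derivative of a quasidifferentiable function has a continuous sublinear
majorant all of whose linear minorants belong to `demcoqd f x`. -/
theorem QDAt.exists_majorant {f : X → ℝ} {x : X} (hf : QDAt f x) :
    ∃ P : X → ℝ, IsSLin P ∧ (∀ v, ∃ L ≤ P v, HasDirDeriv f x v L) ∧
      ∀ ξ : StrongDual ℝ X, (∀ v, ξ v ≤ P v) → ξ ∈ demcoqd f x := by
  obtain ⟨p, q, hp, hq, hd⟩ := hf
  obtain ⟨A, hA, hA'⟩ := hp.exists_supp_eq
  obtain ⟨B, hB, hB'⟩ := hq.exists_supp_eq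
  obtain ⟨P, hP, hle, hclarke⟩ := hp.exists_le_clarkeDeriv_sub hq
  refine ⟨P, hP, fun v => ⟨_, hle v, hd v⟩, fun ξ hξ => ?_⟩
  have hAB : (A, B) ∈ quasidiff f x :=
    ⟨hA, hB, fun v => by simpa only [hA', hB'] using hd v⟩
  rw [demcoqd_eq_demDiff hAB]
  intro v
  simp only [hA', hB']
  exact (EReal.coe_le_coe_iff.2 (hξ v)).trans (hclarke v)

/-- A directional derivative at a minimizer of `φ + c * dist · x` is at least `-c‖v‖`. -/
theorem HasDirDeriv.nonneg_add {φ : X → ℝ} {x v : X} {L c : ℝ} (hφ : HasDirDeriv φ x v L)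
    (hmin : ∀ y, φ x ≤ φ y + c * dist y x) : 0 ≤ L + c * ‖v‖ := by
  suffices h : -(c * ‖v‖) ≤ L by linarith
  refine ge_of_tendsto hφ ?_
  filter_upwards [self_mem_nhdsWithin] with t ht
  have ht' : 0 < t := ht
  have h1 := hmin (x + t • v)
  rw [dist_eq_norm, add_sub_cancel_left, norm_smul, Real.norm_of_nonneg ht'.le] at h1
  rw [le_div_iff₀ ht']
  linarith

/-- A sum rule at a minimizer of `φ + c * dist · x` for `φ = f₁ + f₂`. -/
theorem exists_demcoqd_add_norm_le {f₁ f₂ : X → ℝ} {x : X} (h₁ : QDAt f₁ x) (h₂ : QDAt f₂ x)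
    {c : ℝ} (hc : 0 ≤ c) (hmin : ∀ y, f₁ x + f₂ x ≤ f₁ y + f₂ y + c * dist y x) :
    ∃ ξ ∈ demcoqd f₁ x + demcoqd f₂ x, ‖ξ‖ ≤ c := by
  obtain ⟨P₁, hP₁, hd₁, hm₁⟩ := h₁.exists_majorant
  obtain ⟨P₂, hP₂, hd₂, hm₂⟩ := h₂.exists_majorant
  obtain ⟨ξ, hξc, hξ⟩ := (hP₁.add hP₂).exists_norm_le hc (fun v => by
    obtain ⟨L₁, hL₁, hd₁⟩ := hd₁ v
    obtain ⟨L₂, hL₂, hd₂⟩ := hd₂ v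
    linarith [(hd₁.add hd₂).nonneg_add hmin])
  obtain ⟨ξ₁, ξ₂, hsum, hξ₁, hξ₂⟩ := hP₁.exists_add_eq hP₂ ξ hξ
  exact ⟨ξ, hsum ▸ add_mem_add (hm₁ ξ₁ hξ₁) (hm₂ ξ₂ hξ₂), hξc⟩

/-- A sum rule at a minimizer of `φ + c * dist · x` for `φ = f₁ + k (f₂ + f₃)`. -/
theorem exists_demcoqd_norm_le {f₁ f₂ f₃ : X → ℝ} {x : X} (h₁ : QDAt f₁ x) (h₂ : QDAt f₂ x)
    (h₃ : QDAt f₃ x) {k c : ℝ} (hk : 0 < k) (hc : 0 ≤ c)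
    (hmin : ∀ y, f₁ x + k * (f₂ x + f₃ x) ≤ f₁ y + k * (f₂ y + f₃ y) + c * dist y x) :
    ∃ ξ ∈ demcoqd f₁ x + k • (demcoqd f₂ x + demcoqd f₃ x), ‖ξ‖ ≤ c := by
  obtain ⟨P₁, hP₁, hd₁, hm₁⟩ := h₁.exists_majorant
  obtain ⟨P₂, hP₂, hd₂, hm₂⟩ := h₂.exists_majorant
  obtain ⟨P₃, hP₃, hd₃, hm₃⟩ := h₃.exists_majorant
  have hR := (hP₂.add hP₃).const_mul hk.le
  obtain ⟨ξ, hξc, hξ⟩ := (hP₁.add hR).exists_norm_le hc (fun v => by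
    obtain ⟨L₁, hL₁, hd₁⟩ := hd₁ v
    obtain ⟨L₂, hL₂, hd₂⟩ := hd₂ v
    obtain ⟨L₃, hL₃, hd₃⟩ := hd₃ v
    have h4 := (hd₁.add ((hd₂.add hd₃).const_mul k)).nonneg_add hmin
    have h5 := mul_le_mul_of_nonneg_left (add_le_add hL₂ hL₃) hk.le
    linarith)
  obtain ⟨ξ₁, η, hsum, hξ₁, hη⟩ := hP₁.exists_add_eq hR ξ hξ
  -- Dividing by `k` before the second splitting makes the pieces minorants of `P₂` and `P₃`
  -- themselves.
  obtain ⟨ξ₂, ξ₃, hsum', hξ₂, hξ₃⟩ := hP₂.exists_add_eq hP₃ (k⁻¹ • η) fun v => by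
    change k⁻¹ * η v ≤ _
    rw [inv_mul_le_iff₀ hk]
    exact hη v
  refine ⟨ξ, ?_, hξc⟩
  rw [← hsum, ← smul_inv_smul₀ hk.ne' η, ← hsum']
  exact add_mem_add (hm₁ ξ₁ hξ₁) (smul_mem_smul_set (add_mem_add (hm₂ ξ₂ hξ₂) (hm₃ ξ₃ hξ₃)))

theorem le_norm_of_ofReal_le_infEDist {A : Set (StrongDual ℝ X)} {ζ : ℝ}
    (h : ENNReal.ofReal ζ ≤ Metric.infEDist 0 A) {ξ : StrongDual ℝ X} (hξ : ξ ∈ A) : ζ ≤ ‖ξ‖ := by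
  have h1 := h.trans (Metric.infEDist_le_edist_of_mem hξ)
  rw [edist_dist, dist_zero_left] at h1
  exact (ENNReal.ofReal_le_ofReal_iff (norm_nonneg ξ)).1 h1

end

end QD

/-! ### Exact penalization and the main theorem. -/

theorem mainTheorem5 {X : Type*} [NormedAddCommGroup X] [NormedSpace ℝ X] [CompleteSpace X]
    (f g h : X → ℝ) (hqd : QD.IsQDProblem f g h)
    (hsol : (QD.argminOn f (QD.feasible g h)).Nonempty)
    (τ : ℝ) (hτ : 0 < τ)
    (hnd : ENNReal.ofReal τ ≤ ⨅ x ∈ (QD.feasible g h)ᶜ,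
      Metric.infEDist (0 : StrongDual ℝ X)
        (QD.demcoqd (fun y => max (g y) 0) x + QD.demcoqd (fun y => |h y|) x))
    (ℓ : ℝ≥0) (hf : LipschitzWith ℓ f)
    (lam : ℝ) (hlam : (ℓ : ℝ) < lam) (ζ : ℝ) (hζ : 0 < ζ)
    (hnd' : ENNReal.ofReal ζ ≤ ⨅ x ∈ (QD.argminOn f (QD.feasible g h))ᶜ,
      Metric.infEDist (0 : StrongDual ℝ X)
        (QD.demcoqd f x + (lam * τ⁻¹) •
          (QD.demcoqd (fun y => max (g y) 0) x + QD.demcoqd (fun y => |h y|) x))) :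
    QD.AdmitsWeakSharp f (QD.feasible g h) ∧
      (ζ : EReal) ≤ QD.wsharModulus f (QD.feasible g h) := by
  set Ω := QD.feasible g h
  set S := QD.argminOn f Ω
  set ρ : X → ℝ := fun y => max (g y) 0 + |h y| with hρ
  have hρ0 : ∀ y, 0 ≤ ρ y := fun y => add_nonneg (le_max_right _ _) (abs_nonneg _)
  have hρΩ : ∀ y ∈ Ω, ρ y = 0 := fun y hy => by
    simp only [hρ, max_eq_right hy.1, hy.2, abs_zero, add_zero]
  have hρlsc : LowerSemicontinuous ρ :=
    (hqd.lsc_g.sup lowerSemicontinuous_const).add hqd.continuous_h.abs.lowerSemicontinuous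
  obtain ⟨x₀, hx₀⟩ := hsol
  have hΩne : Ω.Nonempty := ⟨x₀, hx₀.1⟩
  have herr : ∀ x, τ * Metric.infDist x Ω ≤ ρ x := by
    intro x
    have hdec : ∀ z ∉ Ω, ∀ c, 0 < c → c < τ → ∃ y, ρ y + c * dist y z < ρ z := by
      intro z hz c hc hcτ
      by_contra! hmin
      obtain ⟨ξ, hξ, hξc⟩ := QD.exists_demcoqd_add_norm_le (hqd.qd_g z).posPart (hqd.qd_h z).abs
        hc.le hmin
      linarith [QD.le_norm_of_ofReal_le_infEDist (hnd.trans (iInf₂_le z hz)) hξ]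
    simpa using QD.mul_infDist_le_of_forall_exists_lt hρlsc hρ0 hρΩ hτ hdec x
  have hlam0 : 0 < lam := ℓ.2.trans_lt hlam
  have hk : 0 < lam * τ⁻¹ := mul_pos hlam0 (inv_pos.2 hτ)
  let φ : X → ℝ := fun y => f y + lam * τ⁻¹ * ρ y
  have hφΩ : ∀ y ∈ Ω, φ y = f y := fun y hy => by simp only [φ, hρΩ y hy, mul_zero, add_zero]
  have hφlsc : LowerSemicontinuous φ := by
    refine hf.continuous.lowerSemicontinuous.add ?_
    exact (continuous_const.mul continuous_id).comp_lowerSemicontinuous hρlsc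
      fun a b hab => mul_le_mul_of_nonneg_left hab hk.le
  -- Exact penalty: `f x₀ - f x ≤ ℓ dist(x, Ω) ≤ lam dist(x, Ω) ≤ lam τ⁻¹ ρ x`. The distance to `Ω`
  -- need not be attained, hence the passage through the infimum.
  have hφm : ∀ x, f x₀ ≤ φ x := by
    intro x
    have h1 : f x₀ - f x ≤ ℓ * Metric.infDist x Ω := by
      rw [Metric.infDist_eq_iInf]
      have : Nonempty Ω := hΩne.to_subtype
      rw [Real.mul_iInf_of_nonneg ℓ.coe_nonneg]
      refine le_ciInf fun y => ?_
      have h2 := hx₀.2 y y.2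
      have h3 := (le_abs_self _).trans (hf.dist_le_mul y x)
      rw [dist_comm (y : X) x] at h3
      linarith
    have h2 : lam * Metric.infDist x Ω ≤ lam * τ⁻¹ * ρ x := by
      rw [mul_assoc]
      refine mul_le_mul_of_nonneg_left ?_ hlam0.le
      rw [le_inv_mul_iff₀ hτ]
      exact herr x
    have h3 := mul_le_mul_of_nonneg_right hlam.le (Metric.infDist_nonneg (x := x) (s := Ω))
    change f x₀ ≤ f x + lam * τ⁻¹ * ρ x
    linarith
  have hφS : ∀ y ∈ S, φ y = f x₀ := fun y hy =>
    (hφΩ y hy.1).trans (le_antisymm (hy.2 x₀ hx₀.1) (hx₀.2 y hy.1))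
  have hinf : sInf (f '' Ω) = f x₀ :=
    IsLeast.csInf_eq ⟨⟨x₀, hx₀.1, rfl⟩, by rintro _ ⟨y, hy, rfl⟩; exact hx₀.2 y hy⟩
  have hsharp : QD.WeakSharpIneq f Ω ζ := by
    intro x hx
    have hdec : ∀ z ∉ S, ∀ c, 0 < c → c < ζ → ∃ y, φ y + c * dist y z < φ z := by
      intro z hz c hc hcζ
      by_contra! hmin
      obtain ⟨ξ, hξ, hξc⟩ := QD.exists_demcoqd_norm_le (hqd.qd_f z) (hqd.qd_g z).posPart
        (hqd.qd_h z).abs hk hc.le hmin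
      linarith [QD.le_norm_of_ofReal_le_infEDist (hnd'.trans (iInf₂_le z hz)) hξ]
    rw [hinf, ← hφΩ x hx]
    exact QD.mul_infDist_le_of_forall_exists_lt hφlsc hφm hφS hζ hdec x
  exact ⟨⟨⟨x₀, hx₀⟩, ζ, hζ, hsharp⟩,
    le_iSup (fun σ : {σ : ℝ // 0 < σ ∧ QD.WeakSharpIneq f Ω σ} => ((σ : ℝ) : EReal)) ⟨ζ, hζ, hsharp⟩⟩
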